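/- Let $\mathbb H$ be the real quaternions and $U(\mathbb H)=\{q\in\mathbb H:|q|=1\}$. Let $(\Gamma,\psi)$ be a $U(\mathbb H)$-gain graph: $\Gamma$ is a finite simple graph with vertex set $V$, and $\psi$ assigns to each ordered pair of adjacent vertices an element of $U(\mathbb H)$ with $\psi(u,v)=\psi(v,u)^{-1}$. Put $\psi(u,v)=0$ when $u,v$ are not adjacent; the adjacency matrix is $A_{(\Gamma,\psi)}=(\psi(u,v))_{u,v\in V}$, a Hermitian matrix over $\mathbb H$. Let $\alpha=\{C_0,C_1,\dots,C_k\}$ be a partition of $V$ and write $\Psi_i^{\mathbb H}(v)=\sum_{w\in C_i,\,w\sim v}\psi(v,w)\in\mathbb H$. Suppose that $\alpha$ is a quaternionic GM partition, that is: - for all $i,j\in\{1,\dots,k\}$ and all $v,v'\in C_i$, $\Psi_j^{\mathbb H}(v)=\Psi_j^{\mathbb H}(v')$; - for every $v\in C_0$ and every $i\in\{1,\dots,k\}$, at least one of the following holds: (1) there are $q_1,q_2\in U(\mathbb H)\cup\{0\}$ such that $\psi(v,w)=q_1$ for half of the vertices $w\in C_i$ and $\psi(v,w)=q_2$ for the other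 half (for $q_1=q_2$ this means that $\psi(v,w)=q_1$ for all $w\in C_i$, with no condition on the parity of $|C_i|$); (2) $\Psi_i^{\mathbb H}(v)=0$. Let $(\Gamma,\psi)^{\alpha,\mathbb H}=(\Gamma^{\alpha,\mathbb H},\psi^{\alpha,\mathbb H})$ be the $U(\mathbb H)$-gain graph on $V$ with the same adjacencies and gains as $(\Gamma,\psi)$ between two vertices of $C_0$ and between two vertices of $C_1\cup\dots\cup C_k$, and such that for $v\in C_0$, $i\in\{1,\dots,k\}$ and $w\in C_i$: in case (1), $\psi^{\alpha,\mathbb H}(v,w)=q_2$ if $\psi(v,w)=q_1$, and $\psi^{\alpha,\mathbb H}(v,w)=q_1$ if $\psi(v,w)=q_2$ (the value $0$ again meaning non-adjacency); if (1) fails, so that (2) holds, $\psi^{\alpha,\mathbb H}(v,w)=-\psi(v,w)$; in both cases the gains from $w$ to $v$ are the inverses. Then $(\Gamma,\psi)$ and $(\Gamma,\psi)^{\alpha,\mathbb H}$ are right cospectral: their adjacency matrices have the same right spectrum. Here the right spectrum of a Hermitian matrix $A$ over $\mathbb H$ is the multiset of diagonal entries of a real diagonal matrix $D$ with $U^*AU=D$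 for some unitary matrix $U$ over $\mathbb H$. -/

import Mathlib

open scoped Quaternion Matrix

/-- A `G`-gain graph on the vertex set `V`: a simple graph together with a map from its darts (the
ordered pairs of adjacent vertices) to `G`, with `ψ(u, v) = ψ(v, u)⁻¹`. -/
structure GainGraph (G : Type*) [Group G] (V : Type*) where
  graph : SimpleGraph V
  gain : graph.Dart → G
  gain_symm : ∀ d : graph.Dart, gain d = (gain d.symm)⁻¹

/-- The group `U(ℍ)` of quaternions of norm `1`, with quaternion multiplication. -/
abbrev UnitQuaternion : Type := Metric.sphere (0 : ℍ[ℝ]) 1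

namespace GainGraph

section Entries

variable {V : Type*}

open Classical in
/-- The adjacency matrix in `M_V(ℍ)` of a `U(ℍ)`-gain graph: the gain `ψ(v, w)` if `v` and `w` are
adjacent, and `0` otherwise. -/
noncomputable def adjMatrix (Γ : GainGraph UnitQuaternion V) : Matrix V V ℍ[ℝ] :=
  fun v w => if h : Γ.graph.Adj v w then (Γ.gain ⟨(v, w), h⟩ : ℍ[ℝ]) else 0

lemma adjMatrix_self (Γ : GainGraph UnitQuaternion V) (v : V) : Γ.adjMatrix v v = 0 := by
  simp [adjMatrix]

lemma adjMatrix_mem (Γ : GainGraph UnitQuaternion V) (v w : V) :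
    Γ.adjMatrix v w = 0 ∨ ‖Γ.adjMatrix v w‖ = 1 := by
  unfold adjMatrix
  split_ifs with h
  · right
    simp
  · left; rfl

lemma inv_eq_star_of_norm_one {q : ℍ[ℝ]} (h : ‖q‖ = 1) : q⁻¹ = star q := by
  apply inv_eq_of_mul_eq_one_right
  rw [Quaternion.self_mul_star, Quaternion.normSq_eq_norm_mul_self, h]
  simp

lemma adjMatrix_star (Γ : GainGraph UnitQuaternion V) (v w : V) :
    star (Γ.adjMatrix v w) = Γ.adjMatrix w v := by
  unfold adjMatrix
  by_cases h : Γ.graph.Adj v w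
  · have hs := Γ.gain_symm ⟨(w, v), h.symm⟩
    have hn : ‖(Γ.gain ⟨(v, w), h⟩ : ℍ[ℝ])‖ = 1 := by simp
    rw [dif_pos h, dif_pos h.symm, hs, ← inv_eq_star_of_norm_one hn]
    rfl
  · have h2 : ¬ Γ.graph.Adj w v := fun h2 => h h2.symm
    rw [dif_neg h, dif_neg h2, star_zero]

/-- The `U(ℍ)`-gain graph with a given adjacency matrix: the zero entries are the non-adjacent
pairs, and the other entries are the gains. -/
noncomputable def ofMatrix (B : Matrix V V ℍ[ℝ]) (h0 : ∀ v, B v v = 0)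
    (hB : ∀ v w, star (B v w) = B w v) (hn : ∀ v w, B v w = 0 ∨ ‖B v w‖ = 1) :
    GainGraph UnitQuaternion V where
  graph :=
    { Adj := fun v w => B v w ≠ 0
      symm := ⟨fun v w h => by rw [← hB v w]; simpa using h⟩
      loopless := ⟨fun v h => h (h0 v)⟩ }
  gain := fun d => ⟨B d.fst d.snd, by simpa using (hn d.fst d.snd).resolve_left d.adj⟩
  gain_symm := fun d => by
    apply Subtype.ext
    change B d.fst d.snd = (B d.snd d.fst)⁻¹
    rw [inv_eq_star_of_norm_one ((hn d.snd d.fst).resolve_left d.symm.adj), hB]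

lemma adjMatrix_ofMatrix (B : Matrix V V ℍ[ℝ]) (h0 : ∀ v, B v v = 0)
    (hB : ∀ v w, star (B v w) = B w v) (hn : ∀ v w, B v w = 0 ∨ ‖B v w‖ = 1) :
    (ofMatrix B h0 hB hn).adjMatrix = B := by
  ext1 v w
  unfold adjMatrix
  split_ifs with h
  · rfl
  · exact (not_not.mp h).symm

end Entries

section Switching

variable {V : Type*} [Fintype V] {k : ℕ}

/-- The part `C_i` of the partition `{C_0, …, C_k}` of `V` that is given by the function `c`
sending each vertex to the index of its part. -/
def part (c : V → Fin (k + 1)) (i : Fin (k + 1)) : Finset V :=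
  Finset.univ.filter fun v => c v = i

/-- `Ψ_i^ℍ(v)`: the sum in `ℍ` of the gains `ψ(v, w)` over the neighbours `w` of `v` in `C_i` (the
adjacency matrix vanishes at the other `w`). -/
noncomputable def gainSum (Γ : GainGraph UnitQuaternion V) (c : V → Fin (k + 1))
    (i : Fin (k + 1)) (v : V) : ℍ[ℝ] :=
  ∑ w ∈ part c i, Γ.adjMatrix v w

open Classical in
/-- `v` is joined to half of the vertices of `C_i` with gain `q₁` and to the other half with gain
`q₂`, where `q₁, q₂ ∈ U(ℍ) ∪ {0}` and gain `0` means non-adjacency: only `q₁` and `q₂` occur, and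
they occur equally often. If `q₁ = q₂` this says that all the gains from `v` to `C_i` are `q₁`. -/
def IsHalfHalf (Γ : GainGraph UnitQuaternion V) (c : V → Fin (k + 1)) (v : V) (i : Fin (k + 1))
    (q₁ q₂ : ℍ[ℝ]) : Prop :=
  (q₁ = 0 ∨ ‖q₁‖ = 1) ∧ (q₂ = 0 ∨ ‖q₂‖ = 1) ∧
  (∀ w ∈ part c i, Γ.adjMatrix v w = q₁ ∨ Γ.adjMatrix v w = q₂) ∧
  ((part c i).filter fun w => Γ.adjMatrix v w = q₁).card =
    ((part c i).filter fun w => Γ.adjMatrix v w = q₂).card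

/-- Quaternionic GM partitions. -/
def IsQuaternionicGM (Γ : GainGraph UnitQuaternion V) (c : V → Fin (k + 1)) : Prop :=
  (∀ i j : Fin (k + 1), i ≠ 0 → j ≠ 0 → ∀ v ∈ part c i, ∀ v' ∈ part c i,
      Γ.gainSum c j v = Γ.gainSum c j v') ∧
  (∀ v ∈ part c 0, ∀ i : Fin (k + 1), i ≠ 0 →
      (∃ q₁ q₂ : ℍ[ℝ], Γ.IsHalfHalf c v i q₁ q₂) ∨ Γ.gainSum c i v = 0)

open Classical in
/-- The switched gain (or `0`, for non-adjacency) from `v ∈ C_0` to a vertex `w` of `C_i`, `i ≠ 0`: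
if `v` is half-half joined to `C_i`, then the two gains are swapped (see `crossEntry_eq` for the
independence of the choice of `q₁, q₂`), and otherwise the gain changes its sign. -/
noncomputable def crossEntry (Γ : GainGraph UnitQuaternion V) (c : V → Fin (k + 1)) (v w : V) :
    ℍ[ℝ] :=
  if h : ∃ q : ℍ[ℝ] × ℍ[ℝ], Γ.IsHalfHalf c v (c w) q.1 q.2 then
    if Γ.adjMatrix v w = h.choose.1 then h.choose.2 else h.choose.1
  else -Γ.adjMatrix v w

open Classical in
lemma crossEntry_eq (Γ : GainGraph UnitQuaternion V) (c : V → Fin (k + 1)) (v w : V)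
    (q₁ q₂ : ℍ[ℝ]) (hq : Γ.IsHalfHalf c v (c w) q₁ q₂) :
    Γ.crossEntry c v w = if Γ.adjMatrix v w = q₁ then q₂ else q₁ := by
  have key : ∀ a b a' b' : ℍ[ℝ], Γ.IsHalfHalf c v (c w) a b → Γ.IsHalfHalf c v (c w) a' b' →
      Γ.adjMatrix v w = a → Γ.adjMatrix v w = a' → b = b' := by
    intro a b a' b' h h' e e'
    have haa : a = a' := e.symm.trans e'
    subst haa
    obtain ⟨-, -, h3, h4⟩ := h
    obtain ⟨-, -, h3', h4'⟩ := h'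
    have hpos : 0 < ((part c (c w)).filter fun x => Γ.adjMatrix v x = a).card :=
      Finset.card_pos.mpr ⟨w, by simp [part, e]⟩
    obtain ⟨x, hx⟩ := Finset.card_pos.mp (h4 ▸ hpos)
    obtain ⟨y, hy⟩ := Finset.card_pos.mp (h4' ▸ hpos)
    rw [Finset.mem_filter] at hx hy
    rcases h3' x hx.1 with h | h
    · rcases h3 y hy.1 with h' | h'
      · exact hx.2.symm.trans (h.trans (h'.symm.trans hy.2))
      · exact h'.symm.trans hy.2
    · exact hx.2.symm.trans h
  have hsymm : ∀ a b : ℍ[ℝ], Γ.IsHalfHalf c v (c w) a b → Γ.IsHalfHalf c v (c w) b a :=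
    fun a b h => ⟨h.2.1, h.1, fun x hx => (h.2.2.1 x hx).symm, h.2.2.2.symm⟩
  have hw : w ∈ part c (c w) := by simp [part]
  have hex : ∃ q : ℍ[ℝ] × ℍ[ℝ], Γ.IsHalfHalf c v (c w) q.1 q.2 := ⟨(q₁, q₂), hq⟩
  have hc := hex.choose_spec
  rw [crossEntry, dif_pos hex]
  split_ifs with h1 h2 h2
  · exact key _ _ _ _ hc hq h1 h2
  · exact key _ _ _ _ hc (hsymm _ _ hq) h1 ((hq.2.2.1 w hw).resolve_left h2)
  · exact key _ _ _ _ (hsymm _ _ hc) hq ((hc.2.2.1 w hw).resolve_left h1) h2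
  · exact key _ _ _ _ (hsymm _ _ hc) (hsymm _ _ hq) ((hc.2.2.1 w hw).resolve_left h1)
      ((hq.2.2.1 w hw).resolve_left h2)

lemma crossEntry_mem (Γ : GainGraph UnitQuaternion V) (c : V → Fin (k + 1)) (v w : V) :
    Γ.crossEntry c v w = 0 ∨ ‖Γ.crossEntry c v w‖ = 1 := by
  unfold crossEntry
  split_ifs with h h'
  · exact h.choose_spec.2.1
  · exact h.choose_spec.1
  · rw [neg_eq_zero, norm_neg]
    exact Γ.adjMatrix_mem v w

/-- The adjacency matrix after the switching: the entries between `C_0` and `C_1 ∪ … ∪ C_k` are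
switched, those inside `C_0` and those inside `C_1 ∪ … ∪ C_k` stay. -/
noncomputable def switchedMatrix (Γ : GainGraph UnitQuaternion V) (c : V → Fin (k + 1)) :
    Matrix V V ℍ[ℝ] :=
  fun v w =>
    if c v = 0 ∧ c w ≠ 0 then Γ.crossEntry c v w
    else if c v ≠ 0 ∧ c w = 0 then star (Γ.crossEntry c w v)
    else Γ.adjMatrix v w

/-- The switched gain graph `(Γ, ψ)^{α, ℍ}`, where `α` is the partition given by `c`. -/
noncomputable def switched (Γ : GainGraph UnitQuaternion V) (c : V → Fin (k + 1)) :
    GainGraph UnitQuaternion V :=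
  ofMatrix (Γ.switchedMatrix c)
    (fun v => by
      by_cases h : c v = 0 <;> simp [switchedMatrix, h, adjMatrix_self])
    (fun v w => by
      by_cases h : c v = 0 <;> by_cases h' : c w = 0 <;>
        simp [switchedMatrix, h, h', adjMatrix_star])
    (fun v w => by
      by_cases h : c v = 0 <;> by_cases h' : c w = 0 <;>
        simp only [switchedMatrix, h, h', ne_eq, not_true_eq_false, not_false_eq_true, and_true,
          and_false, and_self, if_true, if_false, star_eq_zero, norm_star]
      · exact Γ.adjMatrix_mem v w
      · exact Γ.crossEntry_mem c v w
      · exact Γ.crossEntry_mem c w v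
      · exact Γ.adjMatrix_mem v w)

end Switching

end GainGraph

/-- The multiset `s` of reals is the right spectrum `σ_r(A)` of the Hermitian quaternionic matrix
`A`: there are a unitary `U` and a real diagonal matrix `D` with `U* A U = D`, and `s` is the
multiset of the diagonal entries of `D`. -/
def IsRightSpectrum {V : Type*} [Fintype V] [DecidableEq V] (A : Matrix V V ℍ[ℝ])
    (s : Multiset ℝ) : Prop :=
  ∃ U ∈ unitary (Matrix V V ℍ[ℝ]), ∃ d : V → ℝ,
    Uᴴ * A * U = Matrix.diagonal (fun v => (d v : ℍ[ℝ])) ∧ s = Finset.univ.val.map d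

/-- Two `U(ℍ)`-gain graphs are right cospectral if their adjacency matrices have the same right
spectrum. -/
def GainGraph.RightCospectral {V W : Type*} [Fintype V] [DecidableEq V] [Fintype W]
    [DecidableEq W] (Γ : GainGraph UnitQuaternion V) (Δ : GainGraph UnitQuaternion W) : Prop :=
  ∃ s : Multiset ℝ, IsRightSpectrum Γ.adjMatrix s ∧ IsRightSpectrum Δ.adjMatrix s

/-! Godsil–McKay switching is conjugation by a unitary involution `Q`: it fixes coordinates in `C_0`
and reflects those in each other `C_i` in their mean. Both GM alternatives make the switch such a
reflection: swapping sends `q` to `q₁ + q₂ - q` with mean `(q₁ + q₂) / 2`, and a sign change is the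
case of mean zero. Between two parts other than `C_0`, constant row and column sums make `Q` commute
with the adjacency matrix. This is `switchedMatrix_mul`; `IsRightSpectrum.of_semiconj` transports a
diagonalization along it. That a right spectrum exists at all is the quaternionic spectral theorem,
obtained by viewing the matrix as a symmetric real operator on `ℍ^V`. -/

lemma Quaternion.re_mul_comm (a b : ℍ[ℝ]) : (a * b).re = (b * a).re := by
  simp only [Quaternion.re_mul]
  ring

/-! ### The spectral theorem over the quaternions. -/

namespace Matrix

variable {V : Type*} [Fintype V]

/-- A quaternionic matrix, acting on column vectors from the left, as a real linear map of the
real inner product space `ℍ^V`. -/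
noncomputable def quaternionToLin (A : Matrix V V ℍ[ℝ]) :
    PiLp 2 (fun _ : V => ℍ[ℝ]) →ₗ[ℝ] PiLp 2 (fun _ : V => ℍ[ℝ]) where
  toFun x := WithLp.toLp 2 (A *ᵥ x.ofLp)
  map_add' x y := by
    simp [Matrix.mulVec_add]
  map_smul' r x := by
    simp [Matrix.mulVec_smul]

/-- The real inner product is the real part of the quaternionic form, since real parts of products
are insensitive to order; that form lets a Hermitian matrix change sides. -/
lemma IsHermitian.isSymmetric_quaternionToLin {A : Matrix V V ℍ[ℝ]} (hA : A.IsHermitian) :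
    A.quaternionToLin.IsSymmetric := by
  intro x y
  simp only [PiLp.inner_apply, Quaternion.inner_def]
  have hre : ∀ f : V → ℍ[ℝ], ∑ v, (f v).re = (∑ v, f v).re := fun f =>
    (map_sum (QuaternionAlgebra.reₗ (-1 : ℝ) 0 (-1)) f _).symm
  have key : ∀ a b : V → ℍ[ℝ], ∑ v, (a v * star (b v)).re = (star b ⬝ᵥ a).re := fun a b => by
    rw [dotProduct, ← hre]
    exact Finset.sum_congr rfl fun v _ => Quaternion.re_mul_comm _ _
  rw [key, key]
  change (star y.ofLp ⬝ᵥ A *ᵥ x.ofLp).re = (star (A *ᵥ y.ofLp) ⬝ᵥ x.ofLp).re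
  rw [star_mulVec, hA.eq, dotProduct_mulVec]

/-- The real linear map sending `y` to the quaternionic products of the vectors `x i`, `i ∈ s`,
with `y`. -/
noncomputable def quaternionPairing (x : V → V → ℍ[ℝ]) (s : Finset V) :
    PiLp 2 (fun _ : V => ℍ[ℝ]) →ₗ[ℝ] (s → ℍ[ℝ]) where
  toFun y i := star (x i) ⬝ᵥ y.ofLp
  map_add' y z := by
    ext1 i
    simp [dotProduct_add]
  map_smul' r y := by
    ext1 i
    simp [dotProduct_smul]

lemma star_dotProduct_self_quaternion (y : PiLp 2 (fun _ : V => ℍ[ℝ])) :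
    star y.ofLp ⬝ᵥ y.ofLp = ((‖y‖ ^ 2 : ℝ) : ℍ[ℝ]) := by
  rw [PiLp.norm_sq_eq_of_L2, dotProduct, ← Quaternion.algebraMap_def, map_sum]
  refine Finset.sum_congr rfl fun v _ => ?_
  rw [Pi.star_apply, Quaternion.star_mul_self, Quaternion.normSq_eq_norm_mul_self, sq]
  rfl

/-- A Hermitian quaternionic matrix has a unit eigenvector with a real eigenvalue in the
orthogonal complement of fewer than `|V|` eigenvectors with real eigenvalues. -/
lemma IsHermitian.exists_quaternion_eigenvector {A : Matrix V V ℍ[ℝ]} (hA : A.IsHermitian)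
    (x : V → V → ℍ[ℝ]) (d : V → ℝ) (s : Finset V) (hs : s.card < Fintype.card V)
    (hx : ∀ i ∈ s, A *ᵥ x i = d i • x i) :
    ∃ (y : V → ℍ[ℝ]) (r : ℝ), (∀ i ∈ s, star (x i) ⬝ᵥ y = 0) ∧ star y ⬝ᵥ y = 1 ∧
      A *ᵥ y = r • y := by
  let W := LinearMap.ker (quaternionPairing x s)
  have hW : ∀ y : PiLp 2 (fun _ : V => ℍ[ℝ]), y ∈ W ↔ ∀ i ∈ s, star (x i) ⬝ᵥ y.ofLp = 0 := by
    intro y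
    rw [LinearMap.mem_ker, funext_iff, Subtype.forall]
    rfl
  -- Each `ℍ`-valued orthogonality condition costs at most four of the `4|V|` real dimensions.
  have hne : W ≠ ⊥ := by
    apply LinearMap.ker_ne_bot_of_finrank_lt
    rw [Module.finrank_pi_fintype, (WithLp.linearEquiv 2 ℝ (V → ℍ[ℝ])).finrank_eq,
      Module.finrank_pi_fintype]
    simpa [Quaternion.finrank_eq_four] using hs
  -- The complement is invariant because the eigenvalues are real: conjugation turns `x i` into a
  -- left eigenvector with the same eigenvalue.
  have hinv : ∀ y ∈ W, A.quaternionToLin y ∈ W := by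
    intro y hy
    rw [hW] at hy ⊢
    intro i hi
    change star (x i) ⬝ᵥ A *ᵥ y.ofLp = 0
    have h : star (x i) ᵥ* A = d i • star (x i) := by
      have := congrArg star (hx i hi)
      rw [star_mulVec, hA.eq] at this
      rw [this]
      ext1 v
      exact Quaternion.star_smul (d i) (x i v)
    rw [dotProduct_mulVec, h, smul_dotProduct, hy i hi, smul_zero]
  have : Nontrivial W := Submodule.nontrivial_iff_ne_bot.mpr hne
  -- The supremum of the Rayleigh quotient on `W` is an eigenvalue; only its being real matters
  -- below.
  obtain ⟨y, hy⟩ := (hA.isSymmetric_quaternionToLin.restrict_invariant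
    hinv).hasEigenvalue_iSup_of_finiteDimensional.exists_hasEigenvector
  generalize (⨆ x : {x : W // x ≠ 0}, _ : ℝ) = r at hy
  have hy0 : (y : PiLp 2 (fun _ : V => ℍ[ℝ])) ≠ 0 := fun h => hy.2 (Subtype.ext h)
  have hAy : A *ᵥ y.1.ofLp = r • y.1.ofLp :=
    congrArg (fun z : W => z.1.ofLp) hy.apply_eq_smul
  refine ⟨‖y.1‖⁻¹ • y.1.ofLp, r, fun i hi => ?_, ?_, ?_⟩
  · rw [dotProduct_smul, (hW _).mp y.2 i hi, smul_zero]
  · have h := star_dotProduct_self_quaternion (‖y.1‖⁻¹ • y.1)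
    rw [norm_smul, norm_inv, norm_norm, inv_mul_cancel₀ (norm_ne_zero_iff.mpr hy0)] at h
    simpa using h
  · rw [mulVec_smul, hAy, smul_comm]

lemma IsHermitian.exists_quaternion_orthonormal [DecidableEq V] {A : Matrix V V ℍ[ℝ]}
    (hA : A.IsHermitian) (s : Finset V) :
    ∃ (x : V → V → ℍ[ℝ]) (d : V → ℝ),
      (∀ i ∈ s, ∀ j ∈ s, star (x i) ⬝ᵥ x j = if i = j then 1 else 0) ∧
      ∀ i ∈ s, A *ᵥ x i = d i • x i := by
  induction s using Finset.induction_on with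
  | empty => exact ⟨0, 0, by simp, by simp⟩
  | insert a s ha ih =>
    obtain ⟨x, d, hx, hd⟩ := ih
    obtain ⟨y, r, hxy, hy, hr⟩ := hA.exists_quaternion_eigenvector x d s
      (Finset.card_lt_univ_of_notMem ha) hd
    have hyx : ∀ i ∈ s, star y ⬝ᵥ x i = 0 := fun i hi => by
      rw [star_dotProduct, hxy i hi, star_zero]
    have hsa : ∀ i ∈ s, i ≠ a := fun i hi h => ha (h ▸ hi)
    refine ⟨Function.update x a y, Function.update d a r, ?_, ?_⟩
    · intro i hi j hj
      rw [Finset.mem_insert] at hi hj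
      rcases hi with rfl | hi <;> rcases hj with rfl | hj
      · simpa using hy
      · simp [hsa j hj, (hsa j hj).symm, hyx j hj]
      · simp [hsa i hi, hxy i hi]
      · simpa [hsa i hi, hsa j hj] using hx i hi j hj
    · intro i hi
      rcases Finset.mem_insert.mp hi with rfl | hi
      · simpa using hr
      · simpa [hsa i hi] using hd i hi

/-- The spectral theorem for Hermitian quaternionic matrices. -/
theorem IsHermitian.exists_isRightSpectrum [DecidableEq V] {A : Matrix V V ℍ[ℝ]}
    (hA : A.IsHermitian) : ∃ s, IsRightSpectrum A s := by
  obtain ⟨x, d, hx, hd⟩ := hA.exists_quaternion_orthonormal Finset.univ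
  let U : Matrix V V ℍ[ℝ] := fun v i => x i v
  have hU : Uᴴ * U = 1 := by
    ext1 i j
    exact (hx i (Finset.mem_univ i) j (Finset.mem_univ j)).trans (one_apply).symm
  refine ⟨_, U, ⟨hU, mul_eq_one_symm hU⟩, d, ?_, rfl⟩
  -- The diagonal acts on `U` from the right; real entries are central, so this is the scaling in
  -- `hd`.
  have hAU : A * U = U * diagonal (fun v => (d v : ℍ[ℝ])) := by
    ext1 v i
    rw [mul_diagonal, Quaternion.mul_coe_eq_smul]
    exact congrFun (hd i (Finset.mem_univ i)) v
  rw [Matrix.mul_assoc, hAU, ← Matrix.mul_assoc, hU, Matrix.one_mul]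

end Matrix

lemma IsRightSpectrum.of_semiconj {V : Type*} [Fintype V] [DecidableEq V] {A B Q : Matrix V V ℍ[ℝ]}
    {s : Multiset ℝ} (h : IsRightSpectrum A s) (hQ : Q ∈ unitary (Matrix V V ℍ[ℝ]))
    (hAB : B * Q = Q * A) : IsRightSpectrum B s := by
  obtain ⟨U, hU, d, hd, rfl⟩ := h
  refine ⟨Q * U, mul_mem hQ hU, d, ?_, rfl⟩
  have hQQ : Qᴴ * Q = 1 := hQ.1
  rw [← hd, Matrix.conjTranspose_mul, Matrix.mul_assoc, Matrix.mul_assoc, ← Matrix.mul_assoc B, hAB,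
    Matrix.mul_assoc Q, ← Matrix.mul_assoc Qᴴ, hQQ, Matrix.one_mul, Matrix.mul_assoc]

/-! ### Switching as reflection in means. -/

namespace GainGraph

variable {V : Type*} [Fintype V] {k : ℕ}

lemma isHermitian_adjMatrix {V : Type*} (Γ : GainGraph UnitQuaternion V) : Γ.adjMatrix.IsHermitian := by
  ext1 v w
  exact Γ.adjMatrix_star w v

lemma card_part_pos (c : V → Fin (k + 1)) (v : V) : 0 < (part c (c v)).card :=
  Finset.card_pos.mpr ⟨v, by simp [part]⟩

/-- The mean gain is `(q₁ + q₂) / 2`. The case `q₁ = q₂` is separate: there the two halves coincide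
with the whole part, whose size may be odd. -/
lemma IsHalfHalf.two_smul_gainSum {Γ : GainGraph UnitQuaternion V} {c : V → Fin (k + 1)} {v : V}
    {i : Fin (k + 1)} {q₁ q₂ : ℍ[ℝ]} (h : Γ.IsHalfHalf c v i q₁ q₂) :
    (2 : ℝ) • Γ.gainSum c i v = ((part c i).card : ℝ) • (q₁ + q₂) := by
  classical
  obtain ⟨-, -, h3, h4⟩ := h
  by_cases hq : q₁ = q₂
  · subst hq
    rw [gainSum, Finset.sum_congr rfl fun w hw => (h3 w hw).elim id id, Finset.sum_const,
      ← two_smul ℝ q₁, smul_comm, Nat.cast_smul_eq_nsmul]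
  · have hfilter : ((part c i).filter fun w => ¬ Γ.adjMatrix v w = q₁) =
        (part c i).filter fun w => Γ.adjMatrix v w = q₂ :=
      Finset.filter_congr fun w hw =>
        ⟨(h3 w hw).resolve_left, fun e e' => hq (e'.symm.trans e)⟩
    have hcard := Finset.card_filter_add_card_filter_not (s := part c i)
      (fun w => Γ.adjMatrix v w = q₁)
    rw [hfilter, ← h4] at hcard
    rw [gainSum, ← Finset.sum_filter_add_sum_filter_not _ (fun w => Γ.adjMatrix v w = q₁), hfilter,
      Finset.sum_congr rfl fun w hw => (Finset.mem_filter.mp hw).2, Finset.sum_const,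
      Finset.sum_congr (g := fun _ => q₂) rfl fun w hw => (Finset.mem_filter.mp hw).2,
      Finset.sum_const, ← h4, ← hcard, ← smul_add, ← Nat.cast_smul_eq_nsmul ℝ, smul_smul]
    congr 1
    push_cast
    ring

/-- In both cases of a quaternionic GM partition, the switching reflects the gains from `v` to
`C_i` in their mean value. -/
lemma IsQuaternionicGM.crossEntry_eq {Γ : GainGraph UnitQuaternion V} {c : V → Fin (k + 1)}
    (hc : Γ.IsQuaternionicGM c) {v w : V} (hv : c v = 0) (hw : c w ≠ 0) :
    Γ.crossEntry c v w =
      (2 / (part c (c w)).card : ℝ) • Γ.gainSum c (c w) v - Γ.adjMatrix v w := by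
  by_cases h : ∃ q : ℍ[ℝ] × ℍ[ℝ], Γ.IsHalfHalf c v (c w) q.1 q.2
  · obtain ⟨⟨q₁, q₂⟩, hq⟩ := h
    have hn : ((part c (c w)).card : ℝ) ≠ 0 := by exact_mod_cast (card_part_pos c w).ne'
    rw [Γ.crossEntry_eq c v w q₁ q₂ hq, div_eq_inv_mul, mul_smul, hq.two_smul_gainSum,
      inv_smul_smul₀ hn]
    split_ifs with h1
    · rw [h1, add_sub_cancel_left]
    · rw [(hq.2.2.1 w (by simp [part])).resolve_left h1, add_sub_cancel_right]
  · have h0 := (hc.2 v (by simp [part, hv]) (c w) hw).resolve_left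
      fun ⟨q₁, q₂, hq⟩ => h ⟨(q₁, q₂), hq⟩
    rw [crossEntry, dif_neg h, h0, smul_zero, zero_sub]

/-- Double counting of the gains between two parts. -/
lemma IsQuaternionicGM.card_smul_gainSum {Γ : GainGraph UnitQuaternion V} {c : V → Fin (k + 1)}
    (hc : Γ.IsQuaternionicGM c) {v w : V} (hv : c v ≠ 0) (hw : c w ≠ 0) :
    ((part c (c v)).card : ℝ) • ∑ u ∈ part c (c w), Γ.adjMatrix v u =
      ((part c (c w)).card : ℝ) • ∑ u ∈ part c (c v), Γ.adjMatrix u w := by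
  have hrow : ∀ v' ∈ part c (c v), ∑ u ∈ part c (c w), Γ.adjMatrix v' u =
      ∑ u ∈ part c (c w), Γ.adjMatrix v u := fun v' hv' =>
    hc.1 (c v) (c w) hv hw v' hv' v (by simp [part])
  -- Column sums are conjugates of row sums, hence also constant.
  have hcol : ∀ w' ∈ part c (c w), ∑ u ∈ part c (c v), Γ.adjMatrix u w' =
      ∑ u ∈ part c (c v), Γ.adjMatrix u w := fun w' hw' => by
    have h := congrArg star (hc.1 (c w) (c v) hw hv w' hw' w (by simp [part]))
    simpa only [gainSum, star_sum, adjMatrix_star] using h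
  rw [Nat.cast_smul_eq_nsmul, Nat.cast_smul_eq_nsmul, ← Finset.sum_const,
    ← Finset.sum_const, ← Finset.sum_congr rfl hrow, ← Finset.sum_congr rfl hcol, Finset.sum_comm]

/-! ### The switching matrix and the intertwining identity. -/

variable [DecidableEq V]

/-- The switching matrix of a partition: the identity on `C_0`, and `2/|C_i| J - I` on `C_i` for
`i ≠ 0`. -/
noncomputable def switchingMatrix (c : V → Fin (k + 1)) : Matrix V V ℍ[ℝ] :=
  fun v w => (((if c v ≠ 0 ∧ c w = c v then 2 / ((part c (c v)).card : ℝ) else 0) +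
    if w = v then (if c v = 0 then 1 else -1) else 0 : ℝ) : ℍ[ℝ])

lemma isHermitian_switchingMatrix (c : V → Fin (k + 1)) : (switchingMatrix c).IsHermitian := by
  ext1 v w
  rw [Matrix.conjTranspose_apply, switchingMatrix, switchingMatrix, Quaternion.star_coe]
  by_cases h : c w = c v
  · simp [h, eq_comm]
  · have h' : v ≠ w := fun e => h (e ▸ rfl)
    simp [h, Ne.symm h, h', h'.symm]

lemma switchingMatrix_mul_apply (c : V → Fin (k + 1)) (X : Matrix V V ℍ[ℝ]) (v w : V) :
    (switchingMatrix c * X) v w = if c v = 0 then X v w else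
      (2 / (part c (c v)).card : ℝ) • ∑ u ∈ part c (c v), X u w - X v w := by
  simp only [Matrix.mul_apply, switchingMatrix, Quaternion.coe_mul_eq_smul, add_smul, Finset.sum_add_distrib, ite_smul, zero_smul,
    Finset.sum_ite_eq', Finset.mem_univ, if_true]
  split_ifs with h
  · simp [h]
  · simp [h, part, Finset.smul_sum, Finset.sum_filter, sub_eq_add_neg]

lemma mul_switchingMatrix_apply (c : V → Fin (k + 1)) (X : Matrix V V ℍ[ℝ]) (v w : V) :
    (X * switchingMatrix c) v w = if c w = 0 then X v w else
      (2 / (part c (c w)).card : ℝ) • ∑ u ∈ part c (c w), X v u - X v w := by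
  have h := congrFun₂ (congrArg Matrix.conjTranspose
    (Matrix.conjTranspose_mul X (switchingMatrix c))) v w
  rw [Matrix.conjTranspose_conjTranspose, (isHermitian_switchingMatrix c).eq,
    Matrix.conjTranspose_apply, switchingMatrix_mul_apply] at h
  rw [h]
  split_ifs <;> simp [Matrix.conjTranspose_apply]

/-- Reflecting in the mean preserves the mean, so doing it twice is the identity. -/
lemma switchingMatrix_mul_self (c : V → Fin (k + 1)) :
    switchingMatrix c * switchingMatrix c = 1 := by
  have hone : switchingMatrix c = switchingMatrix c * 1 := (Matrix.mul_one _).symm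
  ext1 v w
  rw [switchingMatrix_mul_apply]
  split_ifs with h
  · rw [hone, switchingMatrix_mul_apply, if_pos h]
  · have hn : ((part c (c v)).card : ℝ) ≠ 0 := by exact_mod_cast (card_part_pos c v).ne'
    have hu : ∀ u ∈ part c (c v), switchingMatrix c u w =
        (2 / (part c (c v)).card : ℝ) • ∑ t ∈ part c (c v), (1 : Matrix V V ℍ[ℝ]) t w -
          (1 : Matrix V V ℍ[ℝ]) u w := by
      intro u hu
      have hcu : c u = c v := (Finset.mem_filter.mp hu).2
      rw [hone, switchingMatrix_mul_apply, hcu, if_neg h]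
    rw [hu v (by simp [part]), Finset.sum_congr rfl hu, Finset.sum_sub_distrib, Finset.sum_const,
      ← Nat.cast_smul_eq_nsmul ℝ, smul_smul, mul_div_cancel₀ _ hn]
    module

lemma switchingMatrix_mem_unitary (c : V → Fin (k + 1)) :
    switchingMatrix c ∈ unitary (Matrix V V ℍ[ℝ]) := by
  rw [Unitary.mem_iff, Matrix.star_eq_conjTranspose, (isHermitian_switchingMatrix c).eq]
  exact ⟨switchingMatrix_mul_self c, switchingMatrix_mul_self c⟩

/-- Compare blocks. On mixed blocks `Q` acts on one side only, by the reflection that defines the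
switch. Off `C_0` both sides are twice a mean minus the old entry: a row mean on the left, a column
mean on the right. -/
lemma IsQuaternionicGM.switchedMatrix_mul {Γ : GainGraph UnitQuaternion V} {c : V → Fin (k + 1)}
    (hc : Γ.IsQuaternionicGM c) :
    Γ.switchedMatrix c * switchingMatrix c = switchingMatrix c * Γ.adjMatrix := by
  ext1 v w
  rw [mul_switchingMatrix_apply, switchingMatrix_mul_apply]
  by_cases hv : c v = 0 <;> by_cases hw : c w = 0
  · simp [hv, hw, switchedMatrix]
  · rw [if_neg hw, if_pos hv]
    have hn : ((part c (c w)).card : ℝ) ≠ 0 := by exact_mod_cast (card_part_pos c w).ne'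
    have hu : ∀ u ∈ part c (c w), Γ.switchedMatrix c v u =
        (2 / (part c (c w)).card : ℝ) • Γ.gainSum c (c w) v - Γ.adjMatrix v u := by
      intro u hu
      have hcu : c u = c w := (Finset.mem_filter.mp hu).2
      rw [switchedMatrix, if_pos ⟨hv, hcu ▸ hw⟩, hc.crossEntry_eq hv (hcu ▸ hw), hcu]
    rw [hu w (by simp [part]), Finset.sum_congr rfl hu, Finset.sum_sub_distrib, Finset.sum_const,
      ← Nat.cast_smul_eq_nsmul ℝ, smul_smul, mul_div_cancel₀ _ hn, ← gainSum]
    module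
  · rw [if_pos hw, if_neg hv, switchedMatrix, if_neg (fun h => hv h.1), if_pos ⟨hv, hw⟩,
      hc.crossEntry_eq hw hv]
    simp only [gainSum, star_sub, Quaternion.star_smul, star_sum, adjMatrix_star]
  · have hA : ∀ u ∈ part c (c w), Γ.switchedMatrix c v u = Γ.adjMatrix v u := by
      intro u hu
      have hcu : c u = c w := (Finset.mem_filter.mp hu).2
      rw [switchedMatrix, if_neg (fun h => hv h.1), if_neg (fun h => hw (hcu ▸ h.2))]
    have hnv : ((part c (c v)).card : ℝ) ≠ 0 := by exact_mod_cast (card_part_pos c v).ne'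
    have hnw : ((part c (c w)).card : ℝ) ≠ 0 := by exact_mod_cast (card_part_pos c w).ne'
    rw [if_neg hw, if_neg hv, Finset.sum_congr rfl hA, hA w (by simp [part])]
    congr 1
    rw [div_eq_mul_inv, mul_smul, div_eq_mul_inv, mul_smul]
    congr 1
    -- Equality of row and column means, cleared of denominators, is the double count.
    rw [inv_smul_eq_iff₀ hnw, smul_comm, eq_inv_smul_iff₀ hnv]
    exact hc.card_smul_gainSum hv hw

end GainGraph

theorem theorem5p6 {V : Type*} [Fintype V] [DecidableEq V] (Γ : GainGraph UnitQuaternion V)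
    {k : ℕ} (c : V → Fin (k + 1)) (hc : Γ.IsQuaternionicGM c) :
    Γ.RightCospectral (Γ.switched c) := by
  obtain ⟨s, hs⟩ := Γ.isHermitian_adjMatrix.exists_isRightSpectrum
  refine ⟨s, hs, hs.of_semiconj (GainGraph.switchingMatrix_mem_unitary c) ?_⟩
  rw [GainGraph.switched, GainGraph.adjMatrix_ofMatrix, hc.switchedMatrix_mul]
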